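/- Let $\mathcal H$ be a finite-dimensional complex Hilbert space of dimension $n$ (inner product linear in the second variable), and let $V$ be a multiplicative unitary on $\mathcal H\otimes\mathcal H$, i.e. a unitary with $V_{12}V_{13}V_{23}=V_{23}V_{12}$. A vector $\xi$ is called fixed if $V(\xi\otimes\eta)=\xi\otimes\eta$ for all $\eta\in\mathcal H$, and cofixed if $V(\eta\otimes\xi)=\eta\otimes\xi$ for all $\eta\in\mathcal H$. Assume that $V$ has multiplicity $1$, i.e. that its space of fixed vectors has dimension $1$ (so $n\neq 0$), and let $e$ be a fixed vector with $\|e\|=1$. Then there is exactly one cofixed vector $\hat e$ with $\langle e,\hat e\rangle=n^{-1/2}$. For $\xi\in\mathcal H$ put $H^\xi=\{\eta\in\mathcal H : V(\xi\otimes\eta)=\xi\otimes\eta\}$ and $H_\xi=\{\eta\in\mathcal H : V(\eta\otimes\xi)=\eta\otimes\xi\}$. A pre-subgroup of $V$ is a vector $f\in\mathcal H$ with $\|f\|=1$, $\langle f,e\rangle>0$ (real and positive) and $V(f\otimes f)=f\otimes f$. For pre-subgroups $f,g$ write $f\prec g$ if $H^f\subset H^g$. Then $\prec$ is a partial order on the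 set of pre-subgroups of $V$, and this ordered set is a lattice with greatest element $e$ and least element $\hat e$ (in particular $e$ and $\hat e$ are pre-subgroups). More precisely, for any pre-subgroups $f$ and $f'$ there are pre-subgroups $g$ and $g'$ such that $H^f\cap H^{f'}=H^g$ and $H_f\cap H_{f'}=H_{g'}$; moreover $g=\inf(f,f')$ and $g'=\sup(f,f')$. -/

import Mathlib

open scoped TensorProduct ComplexOrder

namespace MultiplicativeUnitary

section Legs

variable {H : Type*} [AddCommGroup H] [Module ℂ H]

/-- The operator `T₁₂` on `H ⊗ H ⊗ H`, acting as `T` on the first two factors. -/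
noncomputable def leg12 (T : H ⊗[ℂ] H →ₗ[ℂ] H ⊗[ℂ] H) :
    H ⊗[ℂ] (H ⊗[ℂ] H) →ₗ[ℂ] H ⊗[ℂ] (H ⊗[ℂ] H) :=
  (TensorProduct.assoc ℂ H H H).toLinearMap ∘ₗ T.rTensor H ∘ₗ
    (TensorProduct.assoc ℂ H H H).symm.toLinearMap

/-- The operator `T₂₃` on `H ⊗ H ⊗ H`, acting as `T` on the last two factors. -/
noncomputable def leg23 (T : H ⊗[ℂ] H →ₗ[ℂ] H ⊗[ℂ] H) :
    H ⊗[ℂ] (H ⊗[ℂ] H) →ₗ[ℂ] H ⊗[ℂ] (H ⊗[ℂ] H) :=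
  T.lTensor H

/-- The flip of the last two factors of `H ⊗ H ⊗ H`. -/
noncomputable def flip23 : H ⊗[ℂ] (H ⊗[ℂ] H) →ₗ[ℂ] H ⊗[ℂ] (H ⊗[ℂ] H) :=
  (TensorProduct.comm ℂ H H).toLinearMap.lTensor H

/-- The operator `T₁₃` on `H ⊗ H ⊗ H`, acting as `T` on the first and third factors. -/
noncomputable def leg13 (T : H ⊗[ℂ] H →ₗ[ℂ] H ⊗[ℂ] H) :
    H ⊗[ℂ] (H ⊗[ℂ] H) →ₗ[ℂ] H ⊗[ℂ] (H ⊗[ℂ] H) :=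
  flip23 ∘ₗ leg12 T ∘ₗ flip23

end Legs

variable {H : Type*} [NormedAddCommGroup H] [InnerProductSpace ℂ H]

/-- The unitary `V` of `H ⊗ H` is multiplicative: `V₁₂ V₁₃ V₂₃ = V₂₃ V₁₂`. -/
def IsMultiplicative (V : (H ⊗[ℂ] H) ≃ₗᵢ[ℂ] (H ⊗[ℂ] H)) : Prop :=
  leg12 (V.toLinearEquiv : H ⊗[ℂ] H →ₗ[ℂ] H ⊗[ℂ] H) ∘ₗ
      leg13 (V.toLinearEquiv : H ⊗[ℂ] H →ₗ[ℂ] H ⊗[ℂ] H) ∘ₗ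
      leg23 (V.toLinearEquiv : H ⊗[ℂ] H →ₗ[ℂ] H ⊗[ℂ] H) =
    leg23 (V.toLinearEquiv : H ⊗[ℂ] H →ₗ[ℂ] H ⊗[ℂ] H) ∘ₗ
      leg12 (V.toLinearEquiv : H ⊗[ℂ] H →ₗ[ℂ] H ⊗[ℂ] H)

/-- `H^ξ`, the space of all `η` such that `V (ξ ⊗ η) = ξ ⊗ η`. -/
def upperSpace (V : (H ⊗[ℂ] H) ≃ₗᵢ[ℂ] (H ⊗[ℂ] H)) (ξ : H) : Submodule ℂ H where
  carrier := {η | V (ξ ⊗ₜ[ℂ] η) = ξ ⊗ₜ[ℂ] η}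
  add_mem' := by
    intro a b ha hb
    simp only [Set.mem_ofPred_eq] at ha hb ⊢
    rw [TensorProduct.tmul_add, map_add, ha, hb]
  zero_mem' := by simp
  smul_mem' := by
    intro c a ha
    simp only [Set.mem_ofPred_eq] at ha ⊢
    rw [TensorProduct.tmul_smul, map_smul, ha]

/-- `H_ξ`, the space of all `η` such that `V (η ⊗ ξ) = η ⊗ ξ`. -/
def lowerSpace (V : (H ⊗[ℂ] H) ≃ₗᵢ[ℂ] (H ⊗[ℂ] H)) (ξ : H) : Submodule ℂ H where
  carrier := {η | V (η ⊗ₜ[ℂ] ξ) = η ⊗ₜ[ℂ] ξ}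
  add_mem' := by
    intro a b ha hb
    simp only [Set.mem_ofPred_eq] at ha hb ⊢
    rw [TensorProduct.add_tmul, map_add, ha, hb]
  zero_mem' := by simp
  smul_mem' := by
    intro c a ha
    simp only [Set.mem_ofPred_eq] at ha ⊢
    rw [← TensorProduct.smul_tmul', map_smul, ha]

/-- `ξ` is a fixed vector of `V`: `V (ξ ⊗ η) = ξ ⊗ η` for all `η`. -/
def IsFixed (V : (H ⊗[ℂ] H) ≃ₗᵢ[ℂ] (H ⊗[ℂ] H)) (ξ : H) : Prop :=
  ∀ η : H, V (ξ ⊗ₜ[ℂ] η) = ξ ⊗ₜ[ℂ] η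

/-- `ξ` is a cofixed vector of `V`: `V (η ⊗ ξ) = η ⊗ ξ` for all `η`. -/
def IsCofixed (V : (H ⊗[ℂ] H) ≃ₗᵢ[ℂ] (H ⊗[ℂ] H)) (ξ : H) : Prop :=
  ∀ η : H, V (η ⊗ₜ[ℂ] ξ) = η ⊗ₜ[ℂ] ξ

/-- The space of fixed vectors of `V`. -/
def fixedSpace (V : (H ⊗[ℂ] H) ≃ₗᵢ[ℂ] (H ⊗[ℂ] H)) : Submodule ℂ H :=
  ⨅ η : H, lowerSpace V η

theorem mem_fixedSpace (V : (H ⊗[ℂ] H) ≃ₗᵢ[ℂ] (H ⊗[ℂ] H)) (ξ : H) :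
    ξ ∈ fixedSpace V ↔ IsFixed V ξ := by
  rw [fixedSpace, Submodule.mem_iInf]
  exact Iff.rfl

/-- The multiplicity of `V`, the dimension of its space of fixed vectors. -/
noncomputable def mult (V : (H ⊗[ℂ] H) ≃ₗᵢ[ℂ] (H ⊗[ℂ] H)) : ℕ :=
  Module.finrank ℂ (fixedSpace V)

/-- `f` is a pre-subgroup of `V`, relative to the chosen unit fixed vector `e`; the condition
`0 < ⟨f, e⟩` says that this complex number is real and positive. -/
structure IsPreSubgroup (V : (H ⊗[ℂ] H) ≃ₗᵢ[ℂ] (H ⊗[ℂ] H)) (e f : H) : Prop where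
  norm_eq_one : ‖f‖ = 1
  inner_pos : 0 < inner ℂ f e
  map_tmul_self : V (f ⊗ₜ[ℂ] f) = f ⊗ₜ[ℂ] f

/-- The type of pre-subgroups of `V`. -/
def PreSubgroup (V : (H ⊗[ℂ] H) ≃ₗᵢ[ℂ] (H ⊗[ℂ] H)) (e : H) : Type _ :=
  {f : H // IsPreSubgroup V e f}

end MultiplicativeUnitary

/-! Write P_f = (ω_{f,f} ⊗ id)V, which is `leftSlice V f`. For a unit vector f with V(f ⊗ f) = f ⊗ f
the pentagon makes P_f idempotent. It is also a contraction, so it is the orthogonal projection onto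
H^f. Multiplicity one gives P_e' = ⟨e', e⟩e'-type formulas: P_f e = ⟨f, e⟩ f (`leftSlice_fixed`).
Hence H^f determines f once ⟨f, e⟩ > 0, which is antisymmetry.

The pentagon also shows that H^f ⊂ H^g holds exactly when V(g ⊗ f) = g ⊗ f. Passing to ΣV⁻¹Σ
exchanges e with ê and H^f with H_f, so H^f ⊂ H^g is equivalent to H_g ⊂ H_f, and suprema are dual
to infima.

For the infimum, let k be the projection of e onto K = H^f ∩ H^f'. Slices of V⁻¹ along vectors of K
commute with P_f and P_f', so they preserve K and its orthogonal. They act on e by scalars, hence on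
k by the same scalars, and so V(k ⊗ η) = k ⊗ η for η in K. Normalizing k gives the pre-subgroup
(`exists_upperSpace_eq_inf`).

The vector ê comes from χ = (Tr ⊗ id)V: χ/n is the orthogonal projection onto the cofixed vectors,
and ê = √n (χ/n)e. -/

namespace MultiplicativeUnitary

/-! ### Equality in Cauchy–Schwarz and contractive idempotents. -/

section InnerProduct

variable {E : Type*} [NormedAddCommGroup E] [InnerProductSpace ℂ E]

theorem eq_of_norm_le_of_re_inner_eq {x y : E} (h : ‖x‖ ≤ ‖y‖)
    (h' : RCLike.re (inner ℂ x y) = ‖y‖ ^ 2) : x = y := by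
  have h1 := @norm_sub_sq ℂ E _ _ _ x y
  have h2 : ‖x‖ ^ 2 ≤ ‖y‖ ^ 2 := by gcongr
  have h3 : ‖x - y‖ ^ 2 ≤ 0 := by rw [h1, h']; linarith
  have h4 : ‖x - y‖ = 0 := by nlinarith [norm_nonneg (x - y), sq_nonneg ‖x - y‖]
  exact sub_eq_zero.1 (norm_eq_zero.1 h4)

/-- An idempotent contraction is self-adjoint. -/
theorem isSymmetric_of_idempotent_of_norm_le [FiniteDimensional ℂ E] {T : E →ₗ[ℂ] E}
    (hT : ∀ x, T (T x) = T x) (hn : ∀ x, ‖T x‖ ≤ ‖x‖) : T.IsSymmetric := by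
  have hadj : ∀ y, ‖LinearMap.adjoint T y‖ ≤ ‖y‖ := by
    intro y
    have h : ‖LinearMap.adjoint T y‖ * ‖LinearMap.adjoint T y‖ ≤ ‖LinearMap.adjoint T y‖ * ‖y‖ := by
      rw [← @inner_self_eq_norm_mul_norm ℂ, LinearMap.adjoint_inner_right]
      refine (re_inner_le_norm _ _).trans ?_
      gcongr
      exact hn _
    rcases (norm_nonneg (LinearMap.adjoint T y)).eq_or_lt with h0 | h0
    · rw [← h0]; exact norm_nonneg _
    · exact le_of_mul_le_mul_left h h0
  -- ⟨T*Tx, Tx⟩ = ⟨Tx, T²x⟩ = ‖Tx‖² while T* is a contraction, so T*T = T, and T*T is self-adjoint.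
  have hfix : ∀ x, LinearMap.adjoint T (T x) = T x := by
    intro x
    refine eq_of_norm_le_of_re_inner_eq (hadj _) ?_
    rw [LinearMap.adjoint_inner_left, hT, @inner_self_eq_norm_sq ℂ]
  intro x y
  calc inner ℂ (T x) y = inner ℂ (LinearMap.adjoint T (T x)) y := by rw [hfix]
    _ = inner ℂ x (LinearMap.adjoint T (T y)) := by
      rw [LinearMap.adjoint_inner_left, LinearMap.adjoint_inner_right]
    _ = inner ℂ x (T y) := by rw [hfix]

end InnerProduct

/-! ### Contracting one leg of a tensor. -/

section Slices

variable {E F : Type*} [NormedAddCommGroup E] [InnerProductSpace ℂ E] [FiniteDimensional ℂ E]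
  [NormedAddCommGroup F] [InnerProductSpace ℂ F] [FiniteDimensional ℂ F]

/-- Contraction of the right leg against `a`. -/
noncomputable def rightContract (E : Type*) [NormedAddCommGroup E] [InnerProductSpace ℂ E]
    [FiniteDimensional ℂ E] (a : F) : E ⊗[ℂ] F →ₗ[ℂ] E :=
  LinearMap.adjoint ((TensorProduct.mk ℂ E F).flip a)

/-- Contraction of the left leg against `a`. -/
noncomputable def leftContract (F : Type*) [NormedAddCommGroup F] [InnerProductSpace ℂ F]
    [FiniteDimensional ℂ F] (a : E) : E ⊗[ℂ] F →ₗ[ℂ] F :=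
  LinearMap.adjoint (TensorProduct.mk ℂ E F a)

theorem inner_rightContract (a : F) (x : E) (t : E ⊗[ℂ] F) :
    inner ℂ x (rightContract E a t) = inner ℂ (x ⊗ₜ[ℂ] a) t := by
  simp [rightContract, LinearMap.adjoint_inner_right]

theorem inner_leftContract (a : E) (x : F) (t : E ⊗[ℂ] F) :
    inner ℂ x (leftContract F a t) = inner ℂ (a ⊗ₜ[ℂ] x) t := by
  simp [leftContract, LinearMap.adjoint_inner_right]

@[simp] theorem rightContract_tmul (a y : F) (x : E) :
    rightContract E a (x ⊗ₜ[ℂ] y) = inner ℂ a y • x := by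
  refine ext_inner_left ℂ fun v => ?_
  rw [inner_rightContract, TensorProduct.inner_tmul, inner_smul_right, mul_comm]

@[simp] theorem leftContract_tmul (a x : E) (y : F) :
    leftContract F a (x ⊗ₜ[ℂ] y) = inner ℂ a x • y := by
  refine ext_inner_left ℂ fun v => ?_
  rw [inner_leftContract, TensorProduct.inner_tmul, inner_smul_right]

theorem sum_rightContract_tmul {ι : Type*} [Fintype ι] (b : OrthonormalBasis ι ℂ F)
    (t : E ⊗[ℂ] F) : ∑ k, rightContract E (b k) t ⊗ₜ[ℂ] b k = t := by
  induction t with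
  | zero => simp
  | tmul x y =>
    simp only [rightContract_tmul, TensorProduct.smul_tmul, ← TensorProduct.tmul_sum]
    rw [b.sum_repr' y]
  | add s t hs ht => simp only [map_add, TensorProduct.add_tmul, Finset.sum_add_distrib, hs, ht]

end Slices

/-! ### The pentagon equation on vectors. -/

section Legs

variable {H : Type*} [NormedAddCommGroup H] [InnerProductSpace ℂ H]
  (V : (H ⊗[ℂ] H) ≃ₗᵢ[ℂ] (H ⊗[ℂ] H))

/-- `V` as a linear endomorphism. -/
abbrev toLin : H ⊗[ℂ] H →ₗ[ℂ] H ⊗[ℂ] H := (V.toLinearEquiv : H ⊗[ℂ] H →ₗ[ℂ] H ⊗[ℂ] H)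

theorem leg12_tmul (T : H ⊗[ℂ] H →ₗ[ℂ] H ⊗[ℂ] H) (x y z : H) :
    leg12 T (x ⊗ₜ[ℂ] (y ⊗ₜ[ℂ] z)) = TensorProduct.assoc ℂ H H H (T (x ⊗ₜ[ℂ] y) ⊗ₜ[ℂ] z) := by
  simp [leg12]

theorem leg12_assoc (T : H ⊗[ℂ] H →ₗ[ℂ] H ⊗[ℂ] H) (t : H ⊗[ℂ] H) (z : H) :
    leg12 T (TensorProduct.assoc ℂ H H H (t ⊗ₜ[ℂ] z)) =
      TensorProduct.assoc ℂ H H H (T t ⊗ₜ[ℂ] z) := by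
  simp [leg12]

theorem leg13_tmul (T : H ⊗[ℂ] H →ₗ[ℂ] H ⊗[ℂ] H) (x y z : H) :
    leg13 T (x ⊗ₜ[ℂ] (y ⊗ₜ[ℂ] z)) =
      flip23 (TensorProduct.assoc ℂ H H H (T (x ⊗ₜ[ℂ] z) ⊗ₜ[ℂ] y)) := by
  simp [leg13, flip23, leg12_tmul]

theorem leg23_tmul (T : H ⊗[ℂ] H →ₗ[ℂ] H ⊗[ℂ] H) (x : H) (t : H ⊗[ℂ] H) :
    leg23 T (x ⊗ₜ[ℂ] t) = x ⊗ₜ[ℂ] T t := by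
  simp [leg23]

theorem leg12_injective : Function.Injective (leg12 (toLin V)) := by
  have h : leg12 (toLin V.symm) ∘ₗ leg12 (toLin V) = LinearMap.id := by
    refine TensorProduct.ext_threefold' fun x y z => ?_
    simp [leg12_tmul, leg12_assoc]
  exact Function.LeftInverse.injective (g := leg12 (toLin V.symm))
    (fun t => LinearMap.congr_fun h t)

variable {V}

theorem IsMultiplicative.apply (hV : IsMultiplicative V) (t : H ⊗[ℂ] (H ⊗[ℂ] H)) :
    leg12 (toLin V) (leg13 (toLin V) (leg23 (toLin V) t)) =
      leg23 (toLin V) (leg12 (toLin V) t) := LinearMap.congr_fun hV t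

variable [FiniteDimensional ℂ H]

/-- In the pentagon at g ⊗ f ⊗ η both V₁₂ and V₂₃ act trivially, hence so does V₁₃. Contracting the
middle leg against f ≠ 0 leaves V(g ⊗ η) = g ⊗ η. -/
theorem IsMultiplicative.upperSpace_le (hV : IsMultiplicative V) {f g : H} (hf : f ≠ 0)
    (hgf : V (g ⊗ₜ[ℂ] f) = g ⊗ₜ[ℂ] f) : upperSpace V f ≤ upperSpace V g := by
  intro η (hη : V (f ⊗ₜ[ℂ] η) = f ⊗ₜ[ℂ] η)
  have h := hV.apply (g ⊗ₜ[ℂ] (f ⊗ₜ[ℂ] η))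
  have h12 : leg12 (toLin V) (g ⊗ₜ[ℂ] (f ⊗ₜ[ℂ] η)) = g ⊗ₜ[ℂ] (f ⊗ₜ[ℂ] η) := by
    simp [leg12_tmul, hgf]
  have h23 : leg23 (toLin V) (g ⊗ₜ[ℂ] (f ⊗ₜ[ℂ] η)) = g ⊗ₜ[ℂ] (f ⊗ₜ[ℂ] η) := by
    simp [leg23_tmul, hη]
  rw [h12, h23] at h
  have h13 := leg12_injective V (h.trans h12.symm)
  have := congrArg (fun t => (leftContract H f).lTensor H (t)) h13
  have key : ∀ s : H ⊗[ℂ] H, (leftContract H f).lTensor H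
      (flip23 (TensorProduct.assoc ℂ H H H (s ⊗ₜ[ℂ] f))) = (inner ℂ f f : ℂ) • s := by
    intro s
    induction s with
    | zero => simp
    | tmul x y => simp [flip23]
    | add s t hs ht => simp only [TensorProduct.add_tmul, map_add, hs, ht, smul_add]
  simp only [leg13_tmul, key] at this
  have hff : (inner ℂ f f : ℂ) ≠ 0 := inner_self_ne_zero.2 hf
  simp only [LinearMap.lTensor_tmul, leftContract_tmul, TensorProduct.tmul_smul] at this
  exact (smul_right_injective _ hff) this

end Legs

variable {H : Type*} [NormedAddCommGroup H] [InnerProductSpace ℂ H]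

/-! ### Duality between fixed and cofixed vectors. -/

section Opposite

/-- The opposite `Σ V⁻¹ Σ` of `V`, where `Σ` is the flip. -/
noncomputable def opposite (V : (H ⊗[ℂ] H) ≃ₗᵢ[ℂ] (H ⊗[ℂ] H)) : (H ⊗[ℂ] H) ≃ₗᵢ[ℂ] (H ⊗[ℂ] H) :=
  ((TensorProduct.commIsometry ℂ H H).trans V.symm).trans (TensorProduct.commIsometry ℂ H H)

variable {V : (H ⊗[ℂ] H) ≃ₗᵢ[ℂ] (H ⊗[ℂ] H)}

theorem opposite_apply (t : H ⊗[ℂ] H) :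
    opposite V t = TensorProduct.comm ℂ H H (V.symm (TensorProduct.comm ℂ H H t)) := rfl

theorem opposite_tmul_eq_iff (x y : H) :
    opposite V (x ⊗ₜ[ℂ] y) = x ⊗ₜ[ℂ] y ↔ V (y ⊗ₜ[ℂ] x) = y ⊗ₜ[ℂ] x := by
  have h : x ⊗ₜ[ℂ] y = TensorProduct.comm ℂ H H (y ⊗ₜ[ℂ] x) := rfl
  rw [opposite_apply, TensorProduct.comm_tmul, h, EmbeddingLike.apply_eq_iff_eq,
    LinearIsometryEquiv.symm_apply_eq, eq_comm]

theorem upperSpace_opposite (f : H) : upperSpace (opposite V) f = lowerSpace V f :=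
  Submodule.ext fun _ => opposite_tmul_eq_iff _ _

theorem isFixed_opposite_iff (f : H) : IsFixed (opposite V) f ↔ IsCofixed V f :=
  forall_congr' fun _ => opposite_tmul_eq_iff _ _

theorem isCofixed_opposite_iff (f : H) : IsCofixed (opposite V) f ↔ IsFixed V f :=
  forall_congr' fun _ => opposite_tmul_eq_iff _ _

/-- Reversal of the three factors of `H ⊗ H ⊗ H`. -/
noncomputable def reverse : H ⊗[ℂ] (H ⊗[ℂ] H) →ₗ[ℂ] H ⊗[ℂ] (H ⊗[ℂ] H) :=
  (TensorProduct.assoc ℂ H H H).toLinearMap ∘ₗ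
    (TensorProduct.comm ℂ H (H ⊗[ℂ] H)).toLinearMap ∘ₗ
      (TensorProduct.comm ℂ H H).toLinearMap.lTensor H

@[simp] theorem reverse_tmul (x y z : H) :
    reverse (x ⊗ₜ[ℂ] (y ⊗ₜ[ℂ] z)) = z ⊗ₜ[ℂ] (y ⊗ₜ[ℂ] x) := by simp [reverse]

theorem reverse_reverse (t : H ⊗[ℂ] (H ⊗[ℂ] H)) : reverse (reverse t) = t := by
  have h : reverse ∘ₗ reverse = (LinearMap.id : H ⊗[ℂ] (H ⊗[ℂ] H) →ₗ[ℂ] _) :=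
    TensorProduct.ext_threefold' fun x y z => by simp
  exact LinearMap.congr_fun h t

theorem leg12_opposite_comp_reverse :
    leg12 (toLin (opposite V)) ∘ₗ reverse = reverse ∘ₗ leg23 (toLin V.symm) := by
  refine TensorProduct.ext_threefold' fun x y z => ?_
  simp only [LinearMap.comp_apply, reverse_tmul, leg12_tmul, leg23_tmul]
  change TensorProduct.assoc ℂ H H H
    (TensorProduct.comm ℂ H H (V.symm (y ⊗ₜ[ℂ] z)) ⊗ₜ[ℂ] x) = reverse (x ⊗ₜ[ℂ] V.symm (y ⊗ₜ[ℂ] z))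
  induction V.symm (y ⊗ₜ[ℂ] z) with
  | zero => simp
  | tmul p q => simp
  | add s t hs ht => simp only [TensorProduct.add_tmul, TensorProduct.tmul_add, map_add, hs, ht]

theorem leg23_opposite_comp_reverse :
    leg23 (toLin (opposite V)) ∘ₗ reverse = reverse ∘ₗ leg12 (toLin V.symm) := by
  refine TensorProduct.ext_threefold' fun x y z => ?_
  simp only [LinearMap.comp_apply, reverse_tmul, leg12_tmul, leg23_tmul]
  change z ⊗ₜ[ℂ] TensorProduct.comm ℂ H H (V.symm (x ⊗ₜ[ℂ] y)) =
    reverse (TensorProduct.assoc ℂ H H H (V.symm (x ⊗ₜ[ℂ] y) ⊗ₜ[ℂ] z))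
  induction V.symm (x ⊗ₜ[ℂ] y) with
  | zero => simp
  | tmul p q => simp
  | add s t hs ht => simp only [TensorProduct.add_tmul, TensorProduct.tmul_add, map_add, hs, ht]

theorem leg13_opposite_comp_reverse :
    leg13 (toLin (opposite V)) ∘ₗ reverse = reverse ∘ₗ leg13 (toLin V.symm) := by
  refine TensorProduct.ext_threefold' fun x y z => ?_
  simp only [LinearMap.comp_apply, reverse_tmul, leg13_tmul]
  change flip23 (TensorProduct.assoc ℂ H H H
      (TensorProduct.comm ℂ H H (V.symm (x ⊗ₜ[ℂ] z)) ⊗ₜ[ℂ] y)) =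
    reverse (flip23 (TensorProduct.assoc ℂ H H H (V.symm (x ⊗ₜ[ℂ] z) ⊗ₜ[ℂ] y)))
  induction V.symm (x ⊗ₜ[ℂ] z) with
  | zero => simp
  | tmul p q => simp [flip23]
  | add s t hs ht => simp only [TensorProduct.add_tmul, map_add, hs, ht]

theorem leg12_symm_comp : leg12 (toLin V.symm) ∘ₗ leg12 (toLin V) = LinearMap.id :=
  TensorProduct.ext_threefold' fun x y z => by simp [leg12_tmul, leg12_assoc]

theorem leg23_symm_comp : leg23 (toLin V.symm) ∘ₗ leg23 (toLin V) = LinearMap.id :=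
  TensorProduct.ext_threefold' fun x y z => by simp [leg23_tmul]

theorem flip23_comp_flip23 :
    (flip23 : H ⊗[ℂ] (H ⊗[ℂ] H) →ₗ[ℂ] _) ∘ₗ flip23 = LinearMap.id :=
  TensorProduct.ext_threefold' fun x y z => by simp [flip23]

theorem leg13_symm_comp : leg13 (toLin V.symm) ∘ₗ leg13 (toLin V) = LinearMap.id := by
  have hf := fun t => LinearMap.congr_fun (flip23_comp_flip23 (H := H)) t
  have h12 := fun t => LinearMap.congr_fun (leg12_symm_comp (V := V)) t
  simp only [LinearMap.comp_apply, LinearMap.id_apply] at hf h12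
  refine LinearMap.ext fun t => ?_
  change flip23 (leg12 _ (flip23 (flip23 (leg12 _ (flip23 t))))) = t
  rw [hf, h12, hf]

/-- Reversing the three legs turns the pentagon of the opposite into the inverse of the pentagon of
V. -/
theorem IsMultiplicative.opposite (hV : IsMultiplicative V) :
    IsMultiplicative (opposite V) := by
  refine LinearMap.ext fun t => ?_
  have h12 := fun t => LinearMap.congr_fun (leg12_opposite_comp_reverse (V := V)) t
  have h13 := fun t => LinearMap.congr_fun (leg13_opposite_comp_reverse (V := V)) t
  have h23 := fun t => LinearMap.congr_fun (leg23_opposite_comp_reverse (V := V)) t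
  have k12 := fun t => LinearMap.congr_fun (leg12_symm_comp (V := V)) t
  have k13 := fun t => LinearMap.congr_fun (leg13_symm_comp (V := V)) t
  have k23 := fun t => LinearMap.congr_fun (leg23_symm_comp (V := V)) t
  have l12 := fun t => LinearMap.congr_fun (leg12_symm_comp (V := V.symm)) t
  have l23 := fun t => LinearMap.congr_fun (leg23_symm_comp (V := V.symm)) t
  simp only [LinearMap.comp_apply, LinearMap.id_apply, LinearIsometryEquiv.symm_symm]
    at h12 h13 h23 k12 k13 k23 l12 l23
  rw [← reverse_reverse t]
  simp only [LinearMap.comp_apply, h12, h13, h23]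
  congr 1
  obtain ⟨s, hs⟩ : ∃ s, reverse t = leg23 (toLin V) (leg12 (toLin V) s) :=
    ⟨leg12 (toLin V.symm) (leg23 (toLin V.symm) (reverse t)), by rw [l12, l23]⟩
  rw [hs, k23, k12, ← hV.apply, k12, k13, k23]

end Opposite

/-! ### Slices of V, the projections onto H^f, and the character. -/

variable [FiniteDimensional ℂ H]
  {V : (H ⊗[ℂ] H) ≃ₗᵢ[ℂ] (H ⊗[ℂ] H)}

/-- The slice `(id ⊗ ω) V`, where `ω = ⟨a, · c⟩`. -/
noncomputable def rightSlice (V : (H ⊗[ℂ] H) ≃ₗᵢ[ℂ] (H ⊗[ℂ] H)) (a c : H) : H →ₗ[ℂ] H :=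
  rightContract H a ∘ₗ toLin V ∘ₗ (TensorProduct.mk ℂ H H).flip c

/-- The slice `(ω ⊗ id) V`, where `ω = ⟨f, · f⟩`. -/
noncomputable def leftSlice (V : (H ⊗[ℂ] H) ≃ₗᵢ[ℂ] (H ⊗[ℂ] H)) (f : H) : H →ₗ[ℂ] H :=
  leftContract H f ∘ₗ toLin V ∘ₗ TensorProduct.mk ℂ H H f

/-- The character `(Tr ⊗ id) V`. -/
noncomputable def character (V : (H ⊗[ℂ] H) ≃ₗᵢ[ℂ] (H ⊗[ℂ] H)) : H →ₗ[ℂ] H :=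
  ∑ i, leftSlice V (stdOrthonormalBasis ℂ H i)

theorem inner_rightSlice (a c x y : H) :
    inner ℂ x (rightSlice V a c y) = inner ℂ (x ⊗ₜ[ℂ] a) (V (y ⊗ₜ[ℂ] c)) :=
  inner_rightContract _ _ _

theorem inner_leftSlice (f x y : H) :
    inner ℂ x (leftSlice V f y) = inner ℂ (f ⊗ₜ[ℂ] x) (V (f ⊗ₜ[ℂ] y)) :=
  inner_leftContract _ _ _

theorem inner_character (a c : H) :
    inner ℂ a (character V c) = LinearMap.trace ℂ H (rightSlice V a c) := by
  rw [LinearMap.trace_eq_sum_inner _ (stdOrthonormalBasis ℂ H), character,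
    LinearMap.sum_apply, inner_sum]
  simp only [inner_rightSlice, inner_leftSlice]

/-- The coproduct formula `∑ (id ⊗ ω_{a,k}) V ⊗ (id ⊗ ω_{k,c}) V = V⁻¹ (1 ⊗ (id ⊗ ω_{a,c}) V) V`. -/
theorem IsMultiplicative.sum_map_rightSlice (hV : IsMultiplicative V) {ι : Type*} [Fintype ι]
    (b : OrthonormalBasis ι ℂ H) (a c : H) :
    ∑ k, TensorProduct.map (rightSlice V a (b k)) (rightSlice V (b k) c) =
      toLin V.symm ∘ₗ (rightSlice V a c).lTensor H ∘ₗ toLin V := by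
  refine TensorProduct.ext' fun x y => ?_
  apply V.injective
  -- This is the pentagon with its third leg contracted against a. Expanding V(y ⊗ c) along the
  -- basis in that leg produces the sum over k.
  have h := congrArg ((rightContract H a).lTensor H) (hV.apply (x ⊗ₜ[ℂ] (y ⊗ₜ[ℂ] c)))
  have h12 : ∀ s : H ⊗[ℂ] (H ⊗[ℂ] H), (rightContract H a).lTensor H (leg12 (toLin V) s) =
      toLin V ((rightContract H a).lTensor H s) := by
    have key : ∀ (t : H ⊗[ℂ] H) (z : H), (rightContract H a).lTensor H
        (TensorProduct.assoc ℂ H H H (t ⊗ₜ[ℂ] z)) = (inner ℂ a z : ℂ) • t := by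
      intro t z
      induction t with
      | zero => simp
      | tmul p q => simp
      | add s t hs ht => simp only [TensorProduct.add_tmul, map_add, hs, ht, smul_add]
    intro s
    have : (rightContract H a).lTensor H ∘ₗ leg12 (toLin V) =
        toLin V ∘ₗ (rightContract H a).lTensor H := by
      refine TensorProduct.ext_threefold' fun p q r => ?_
      simp [leg12_tmul, key]
    exact LinearMap.congr_fun this s
  have hR : (rightContract H a).lTensor H (leg23 (toLin V) (leg12 (toLin V)
      (x ⊗ₜ[ℂ] (y ⊗ₜ[ℂ] c)))) = (rightSlice V a c).lTensor H (V (x ⊗ₜ[ℂ] y)) := by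
    rw [leg12_tmul]
    change (rightContract H a).lTensor H (leg23 (toLin V) (TensorProduct.assoc ℂ H H H
      (V (x ⊗ₜ[ℂ] y) ⊗ₜ[ℂ] c))) = _
    induction V (x ⊗ₜ[ℂ] y) with
    | zero => simp
    | tmul p q => simp [leg23_tmul, rightSlice]
    | add s t hs ht => simp only [TensorProduct.add_tmul, map_add, hs, ht]
  have hL : ∀ t : H ⊗[ℂ] H, (rightContract H a).lTensor H (leg13 (toLin V) (x ⊗ₜ[ℂ] t)) =
      ∑ k, rightSlice V a (b k) x ⊗ₜ[ℂ] rightContract H (b k) t := by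
    intro t
    nth_rw 1 [← sum_rightContract_tmul b t]
    rw [TensorProduct.tmul_sum, map_sum, map_sum]
    refine Finset.sum_congr rfl fun k _ => ?_
    rw [leg13_tmul]
    change _ = rightContract H a (toLin V (x ⊗ₜ[ℂ] b k)) ⊗ₜ[ℂ] _
    induction toLin V (x ⊗ₜ[ℂ] b k) with
    | zero => simp
    | tmul p q => simp [flip23, TensorProduct.smul_tmul]
    | add s t hs ht => simp only [TensorProduct.add_tmul, map_add, hs, ht]
  rw [h12, hR, leg23_tmul, hL] at h
  rw [LinearMap.sum_apply]
  refine h.trans ?_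
  simp

theorem inner_rightSlice_self (f x y : H) :
    inner ℂ f (rightSlice V x y f) = inner ℂ x (leftSlice V f y) := by
  rw [inner_rightSlice, inner_leftSlice]

/-- Evaluate the coproduct formula in the vector state f ⊗ f. Since V fixes f ⊗ f the conjugation
disappears, and the sum over k becomes a matrix product. -/
theorem IsMultiplicative.leftSlice_idempotent (hV : IsMultiplicative V) {f : H} (hf : ‖f‖ = 1)
    (hff : V (f ⊗ₜ[ℂ] f) = f ⊗ₜ[ℂ] f) (c : H) :
    leftSlice V f (leftSlice V f c) = leftSlice V f c := by
  refine ext_inner_left ℂ fun a => ?_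
  have h := congrArg (fun t => inner ℂ (f ⊗ₜ[ℂ] f) t)
    (LinearMap.congr_fun (hV.sum_map_rightSlice (stdOrthonormalBasis ℂ H) a c) (f ⊗ₜ[ℂ] f))
  have h1 : inner ℂ (f ⊗ₜ[ℂ] f) (toLin V.symm ((rightSlice V a c).lTensor H
      (toLin V (f ⊗ₜ[ℂ] f)))) = inner ℂ a (leftSlice V f c) := by
    change inner ℂ (f ⊗ₜ[ℂ] f) (V.symm ((rightSlice V a c).lTensor H (V (f ⊗ₜ[ℂ] f)))) = _
    rw [← V.inner_map_map, V.apply_symm_apply, hff, LinearMap.lTensor_tmul,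
      TensorProduct.inner_tmul, inner_self_eq_norm_sq_to_K, hf, inner_rightSlice_self]
    simp
  simp only [LinearMap.comp_apply] at h
  rw [h1] at h
  rw [← h, LinearMap.sum_apply, inner_sum]
  simp only [TensorProduct.map_tmul, TensorProduct.inner_tmul]
  conv_lhs => rw [← (stdOrthonormalBasis ℂ H).sum_repr' (leftSlice V f c)]
  rw [map_sum, inner_sum]
  refine Finset.sum_congr rfl fun k _ => ?_
  rw [map_smul, inner_smul_right, inner_rightSlice_self, inner_rightSlice_self, mul_comm]

theorem norm_leftSlice_le {f : H} (hf : ‖f‖ = 1) (c : H) : ‖leftSlice V f c‖ ≤ ‖c‖ := by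
  have h : ‖leftSlice V f c‖ * ‖leftSlice V f c‖ ≤ ‖leftSlice V f c‖ * ‖c‖ := by
    rw [← inner_self_eq_norm_mul_norm (𝕜 := ℂ) (leftSlice V f c), inner_leftSlice]
    refine (re_inner_le_norm (𝕜 := ℂ) (E := H ⊗[ℂ] H) _ _).trans ?_
    simp [hf]
  rcases (norm_nonneg (leftSlice V f c)).eq_or_lt with h0 | h0
  · rw [← h0]; exact norm_nonneg _
  · exact le_of_mul_le_mul_left h h0

/-- If P_f c = c, then ⟨f ⊗ c, V(f ⊗ c)⟩ = ‖c‖², the equality case of Cauchy–Schwarz for two vectors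
of norm ‖c‖. -/
theorem leftSlice_eq_self_iff {f : H} (hf : ‖f‖ = 1) (c : H) :
    leftSlice V f c = c ↔ c ∈ upperSpace V f := by
  constructor
  · intro h
    refine eq_of_norm_le_of_re_inner_eq (by simp) ?_
    refine (inner_re_symm (𝕜 := ℂ) (E := H ⊗[ℂ] H) _ _).trans ?_
    rw [← inner_leftSlice, h, inner_self_eq_norm_sq]
    simp [hf]
  · intro (h : V (f ⊗ₜ[ℂ] c) = f ⊗ₜ[ℂ] c)
    refine ext_inner_left ℂ fun a => ?_
    rw [inner_leftSlice, h, TensorProduct.inner_tmul, inner_self_eq_norm_sq_to_K, hf]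
    simp

theorem IsMultiplicative.leftSlice_mem (hV : IsMultiplicative V) {f : H} (hf : ‖f‖ = 1)
    (hff : V (f ⊗ₜ[ℂ] f) = f ⊗ₜ[ℂ] f) (c : H) : leftSlice V f c ∈ upperSpace V f :=
  (leftSlice_eq_self_iff hf _).1 (hV.leftSlice_idempotent hf hff c)

theorem IsMultiplicative.leftSlice_isSymmetric (hV : IsMultiplicative V) {f : H} (hf : ‖f‖ = 1)
    (hff : V (f ⊗ₜ[ℂ] f) = f ⊗ₜ[ℂ] f) : (leftSlice V f).IsSymmetric :=
  isSymmetric_of_idempotent_of_norm_le (hV.leftSlice_idempotent hf hff) (norm_leftSlice_le hf)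

/-- The trace replaces the vector state of the idempotence proof: it ignores conjugation by V, and
the identity leg contributes the factor n. -/
theorem IsMultiplicative.character_character (hV : IsMultiplicative V) (c : H) :
    character V (character V c) = (Module.finrank ℂ H : ℂ) • character V c := by
  refine ext_inner_left ℂ fun a => ?_
  have h := congrArg (LinearMap.trace ℂ (H ⊗[ℂ] H))
    (hV.sum_map_rightSlice (stdOrthonormalBasis ℂ H) a c)
  have h1 : LinearMap.trace ℂ (H ⊗[ℂ] H) (toLin V.symm ∘ₗ (rightSlice V a c).lTensor H ∘ₗ toLin V)
      = Module.finrank ℂ H * LinearMap.trace ℂ H (rightSlice V a c) := by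
    have := LinearMap.trace_conj' ((rightSlice V a c).lTensor H) V.symm.toLinearEquiv
    rw [LinearMap.lTensor, LinearMap.trace_tensorProduct'] at this
    rw [← LinearMap.trace_id ℂ H, ← this]
    rfl
  rw [h1, map_sum] at h
  simp only [LinearMap.trace_tensorProduct', ← inner_character] at h
  rw [inner_smul_right, ← h]
  conv_lhs => rw [← (stdOrthonormalBasis ℂ H).sum_repr' (character V c)]
  rw [map_sum, inner_sum]
  refine Finset.sum_congr rfl fun k _ => ?_
  rw [map_smul, inner_smul_right, mul_comm]

theorem norm_character_le (c : H) : ‖character V c‖ ≤ Module.finrank ℂ H * ‖c‖ := by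
  rw [character, LinearMap.sum_apply]
  refine (norm_sum_le _ _).trans ?_
  refine (Finset.sum_le_sum fun i _ => norm_leftSlice_le
    ((stdOrthonormalBasis ℂ H).norm_eq_one i) c).trans ?_
  simp

theorem IsCofixed.character_apply {c : H} (hc : IsCofixed V c) :
    character V c = (Module.finrank ℂ H : ℂ) • c := by
  rw [character, LinearMap.sum_apply, Finset.sum_congr rfl (fun i _ => (leftSlice_eq_self_iff
    ((stdOrthonormalBasis ℂ H).norm_eq_one i) c).2 (hc _))]
  simp [Nat.cast_smul_eq_nsmul]

omit [FiniteDimensional ℂ H] in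
theorem isCofixed_iff_lowerSpace_eq_top {c : H} : IsCofixed V c ↔ lowerSpace V c = ⊤ :=
  (Submodule.eq_top_iff' (p := lowerSpace V c)).symm

/-- Here n‖c‖² is a sum of n terms, each at most ‖c‖². All are therefore equalities, and each basis
vector lies in H_c. -/
theorem isCofixed_of_character_apply {c : H}
    (hc : character V c = (Module.finrank ℂ H : ℂ) • c) : IsCofixed V c := by
  have hb := (stdOrthonormalBasis ℂ H).norm_eq_one
  have hle : ∀ i ∈ Finset.univ, RCLike.re (inner ℂ c (leftSlice V (stdOrthonormalBasis ℂ H i) c))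
      ≤ ‖c‖ ^ 2 := by
    intro i _
    refine (re_inner_le_norm (𝕜 := ℂ) _ _).trans ?_
    rw [sq]
    gcongr
    exact norm_leftSlice_le (hb i) c
  have hsum : ∑ i, RCLike.re (inner ℂ c (leftSlice V (stdOrthonormalBasis ℂ H i) c)) =
      ∑ _i : Fin (Module.finrank ℂ H), ‖c‖ ^ 2 := by
    rw [← map_sum, ← inner_sum, ← LinearMap.sum_apply, ← character, hc, inner_smul_right,
      inner_self_eq_norm_sq_to_K]
    simp [← Complex.ofReal_pow]
  have heq := (Finset.sum_eq_sum_iff_of_le hle).1 hsum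
  have hmem : ∀ i, stdOrthonormalBasis ℂ H i ∈ lowerSpace V c := by
    intro i
    refine (leftSlice_eq_self_iff (hb i) c).1 (eq_of_norm_le_of_re_inner_eq
      (norm_leftSlice_le (hb i) c) ?_)
    rw [inner_re_symm (𝕜 := ℂ), heq i (Finset.mem_univ i)]
  rw [isCofixed_iff_lowerSpace_eq_top, eq_top_iff, ← (stdOrthonormalBasis ℂ H).toBasis.span_eq,
    Submodule.span_le]
  rintro _ ⟨i, rfl⟩
  simpa using hmem i

theorem IsMultiplicative.lowerSpace_le (hV : IsMultiplicative V) {f g : H} (hg : g ≠ 0)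
    (hgf : V (g ⊗ₜ[ℂ] f) = g ⊗ₜ[ℂ] f) : lowerSpace V g ≤ lowerSpace V f := by
  rw [← upperSpace_opposite, ← upperSpace_opposite]
  exact hV.opposite.upperSpace_le hg ((opposite_tmul_eq_iff _ _).2 hgf)

omit [InnerProductSpace ℂ H] [FiniteDimensional ℂ H] in
theorem ne_zero_of_norm_eq_one {f : H} (hf : ‖f‖ = 1) : f ≠ 0 := by
  rintro rfl
  simp at hf

/-- If the fixed vectors are the multiples of the unit vector `e`, then `(id ⊗ ω_{e,e}) V` is the
orthogonal projection onto the line of `e`. -/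
theorem IsMultiplicative.inner_tmul_fixed (hV : IsMultiplicative V) {e : H} (he : IsFixed V e)
    (he1 : ‖e‖ = 1) (hspan : ∀ ξ, IsFixed V ξ → ∃ c : ℂ, ξ = c • e) (x y : H) :
    inner ℂ (x ⊗ₜ[ℂ] e) (V (y ⊗ₜ[ℂ] e)) = inner ℂ x e * inner ℂ e y := by
  have hee : MultiplicativeUnitary.opposite V (e ⊗ₜ[ℂ] e) = e ⊗ₜ[ℂ] e := (opposite_tmul_eq_iff _ _).2 (he e)
  have hself : inner ℂ e e = (1 : ℂ) := by rw [inner_self_eq_norm_sq_to_K, he1]; simp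
  -- This slice projects onto H_e. As V(e ⊗ η) = e ⊗ η for every η, H_e is contained in every H_η,
  -- so it consists of fixed vectors.
  have hslice : leftSlice (MultiplicativeUnitary.opposite V) e x = inner ℂ e x • e := by
    have hmem := hV.opposite.leftSlice_mem he1 hee x
    rw [upperSpace_opposite] at hmem
    obtain ⟨c, hc⟩ := hspan _ fun η =>
      hV.lowerSpace_le (ne_zero_of_norm_eq_one he1) (he η) hmem
    have h := hV.opposite.leftSlice_isSymmetric he1 hee e x
    rw [(leftSlice_eq_self_iff he1 e).2 hee, hc, inner_smul_right, hself, mul_one] at h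
    rw [hc, h]
  have h : inner ℂ y (leftSlice (MultiplicativeUnitary.opposite V) e x) =
      inner ℂ (y ⊗ₜ[ℂ] e) (V.symm (x ⊗ₜ[ℂ] e)) := by
    rw [inner_leftSlice, opposite_apply, ← TensorProduct.comm_tmul ℂ H H y e,
      TensorProduct.inner_comm_comm, TensorProduct.comm_tmul]
  rw [← V.apply_symm_apply (x ⊗ₜ[ℂ] e), V.inner_map_map, ← inner_conj_symm, ← h, hslice,
    inner_smul_right, map_mul, inner_conj_symm, inner_conj_symm]

/-- Both sides have squared norm |⟨f, e⟩|², which is also their inner product. On the left this is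
‖P_f e‖² = ⟨f ⊗ e, V(f ⊗ e)⟩. -/
theorem IsMultiplicative.leftSlice_fixed (hV : IsMultiplicative V) {e f : H} (he : IsFixed V e)
    (he1 : ‖e‖ = 1) (hspan : ∀ ξ, IsFixed V ξ → ∃ c : ℂ, ξ = c • e) (hf : ‖f‖ = 1)
    (hff : V (f ⊗ₜ[ℂ] f) = f ⊗ₜ[ℂ] f) : leftSlice V f e = inner ℂ f e • f := by
  have hsymm := hV.leftSlice_isSymmetric hf hff
  have h1 : inner ℂ (leftSlice V f e) (leftSlice V f e) = (inner ℂ f e * inner ℂ e f : ℂ) := by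
    rw [hsymm, hV.leftSlice_idempotent hf hff, inner_leftSlice,
      hV.inner_tmul_fixed he he1 hspan]
  have h2 : inner ℂ (leftSlice V f e) (inner ℂ f e • f) = (inner ℂ f e * inner ℂ e f : ℂ) := by
    rw [inner_smul_right, hsymm, (leftSlice_eq_self_iff hf f).2 hff]
  have h3 : ‖(inner ℂ f e : ℂ) • f‖ ^ 2 = RCLike.re (inner ℂ f e * inner ℂ e f : ℂ) := by
    rw [norm_smul, hf, mul_one, ← inner_conj_symm e f, RCLike.mul_conj]
    simp [← Complex.ofReal_pow]
  refine eq_of_norm_le_of_re_inner_eq (le_of_eq ?_) (by rw [h2, h3])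
  rw [← sq_eq_sq₀ (norm_nonneg _) (norm_nonneg _), h3, ← h1, inner_self_eq_norm_sq]

/-- `(ω_{f,f} ⊗ id) V` commutes with the slices of `V⁻¹` along vectors of `H^f`. -/
theorem IsMultiplicative.leftSlice_rightSlice_symm (hV : IsMultiplicative V) {f η : H}
    (hη : η ∈ upperSpace V f) (ω ξ : H) :
    leftSlice V f (rightSlice V.symm ω η ξ) = rightSlice V.symm ω η (leftSlice V f ξ) := by
  have hη' : toLin V (f ⊗ₜ[ℂ] η) = f ⊗ₜ[ℂ] η := hη
  -- V₂₃ sends this vector to f ⊗ ξ ⊗ η, which V₁₃ fixes. Contracting the first leg then gives (P_f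
  -- ⊗ 1)V⁻¹(ξ ⊗ η) = V⁻¹(P_f ξ ⊗ η).
  have h := hV.apply (f ⊗ₜ[ℂ] V.symm (ξ ⊗ₜ[ℂ] η))
  have h13 : leg13 (toLin V) (f ⊗ₜ[ℂ] (ξ ⊗ₜ[ℂ] η)) = f ⊗ₜ[ℂ] (ξ ⊗ₜ[ℂ] η) := by
    rw [leg13_tmul, hη']; simp [flip23]
  have h23 : leg23 (toLin V) (f ⊗ₜ[ℂ] V.symm (ξ ⊗ₜ[ℂ] η)) = f ⊗ₜ[ℂ] (ξ ⊗ₜ[ℂ] η) := by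
    rw [leg23_tmul]; simp
  rw [h23, h13] at h
  have h' := congrArg (leftContract (H ⊗[ℂ] H) f) h
  have hassoc : ∀ t z, leftContract (H ⊗[ℂ] H) f (TensorProduct.assoc ℂ H H H (t ⊗ₜ[ℂ] z)) =
      leftContract H f t ⊗ₜ[ℂ] z := by
    intro t z
    induction t with
    | zero => simp
    | tmul p q => simp [TensorProduct.smul_tmul']
    | add s t hs ht => simp only [TensorProduct.add_tmul, map_add, hs, ht]
  have h12 : ∀ t, leftContract (H ⊗[ℂ] H) f (leg12 (toLin V) (f ⊗ₜ[ℂ] t)) =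
      (leftSlice V f).rTensor H t := by
    intro t
    induction t with
    | zero => simp
    | tmul p q => rw [leg12_tmul, hassoc]; rfl
    | add s t hs ht => simp only [TensorProduct.tmul_add, map_add, hs, ht]
  have hc23 : ∀ t, leftContract (H ⊗[ℂ] H) f (leg23 (toLin V) t) =
      toLin V (leftContract (H ⊗[ℂ] H) f t) := by
    intro t
    induction t with
    | zero => simp
    | tmul p q => simp [leg23_tmul]
    | add s t hs ht => simp only [map_add, hs, ht]
  rw [hc23, h12, h12, LinearMap.rTensor_tmul] at h'
  have h'' : (leftSlice V f).rTensor H (V.symm (ξ ⊗ₜ[ℂ] η)) =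
      V.symm (leftSlice V f ξ ⊗ₜ[ℂ] η) := by
    rw [h']; exact (V.symm_apply_apply _).symm
  change leftSlice V f (rightContract H ω (V.symm (ξ ⊗ₜ[ℂ] η))) =
    rightContract H ω (V.symm (leftSlice V f ξ ⊗ₜ[ℂ] η))
  rw [← h'']
  induction V.symm (ξ ⊗ₜ[ℂ] η) with
  | zero => simp
  | tmul p q => simp
  | add s t hs ht => simp only [map_add, hs, ht]

/-- A multiplicative unitary with a positively normalized pair of unit vectors spanning the fixed
and the cofixed vectors. -/
structure IsUnitPair (V : (H ⊗[ℂ] H) ≃ₗᵢ[ℂ] (H ⊗[ℂ] H)) (e ê : H) : Prop where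
  mul : IsMultiplicative V
  fixed : IsFixed V e
  norm_fixed : ‖e‖ = 1
  fixed_span : ∀ ξ, IsFixed V ξ → ∃ c : ℂ, ξ = c • e
  cofixed : IsCofixed V ê
  norm_cofixed : ‖ê‖ = 1
  cofixed_span : ∀ ξ, IsCofixed V ξ → ∃ c : ℂ, ξ = c • ê
  pos : 0 < inner ℂ ê e

omit [FiniteDimensional ℂ H] in
theorem inner_pos_symm {x y : H} (h : 0 < inner ℂ x y) : 0 < inner ℂ y x := by
  rw [Complex.pos_iff] at h
  rw [← inner_conj_symm y x, Complex.pos_iff, Complex.conj_re, Complex.conj_im, ← h.2, neg_zero]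
  exact ⟨h.1, rfl⟩

omit [FiniteDimensional ℂ H] in
theorem opposite_opposite : opposite (opposite V) = V := by
  ext t
  simp [opposite]

/-! ### The order on pre-subgroups and intersections of the spaces H^f. -/

namespace IsUnitPair

variable {e ê f g : H}

omit [FiniteDimensional ℂ H] in
theorem opposite (P : IsUnitPair V e ê) : IsUnitPair (opposite V) ê e where
  mul := P.mul.opposite
  fixed := (isFixed_opposite_iff _).2 P.cofixed
  norm_fixed := P.norm_cofixed
  fixed_span ξ h := P.cofixed_span ξ ((isFixed_opposite_iff _).1 h)
  cofixed := (isCofixed_opposite_iff _).2 P.fixed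
  norm_cofixed := P.norm_fixed
  cofixed_span ξ h := P.fixed_span ξ ((isCofixed_opposite_iff _).1 h)
  pos := inner_pos_symm P.pos

theorem leftSlice_fixed (P : IsUnitPair V e ê) (hf : IsPreSubgroup V e f) :
    leftSlice V f e = inner ℂ f e • f :=
  P.mul.leftSlice_fixed P.fixed P.norm_fixed P.fixed_span hf.norm_eq_one hf.map_tmul_self

/-- Positivity passes from e to ê because ⟨ê, e⟩ = ⟨P_f ê, e⟩ = ⟨ê, P_f e⟩ = ⟨f, e⟩⟨ê, f⟩. -/
theorem preSubgroup_opposite (P : IsUnitPair V e ê) (hf : IsPreSubgroup V e f) :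
    IsPreSubgroup (MultiplicativeUnitary.opposite V) ê f where
  norm_eq_one := hf.norm_eq_one
  inner_pos := by
    have h := P.mul.leftSlice_isSymmetric hf.norm_eq_one hf.map_tmul_self ê e
    rw [P.leftSlice_fixed hf, (leftSlice_eq_self_iff hf.norm_eq_one ê).2 (P.cofixed f),
      inner_smul_right] at h
    have hpos := P.pos
    rw [h] at hpos
    exact inner_pos_symm ((pos_iff_pos_of_mul_pos hpos).1 hf.inner_pos)
  map_tmul_self := (opposite_tmul_eq_iff _ _).2 hf.map_tmul_self

theorem preSubgroup_of_opposite (P : IsUnitPair V e ê)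
    (hf : IsPreSubgroup (MultiplicativeUnitary.opposite V) ê f) : IsPreSubgroup V e f := by
  have := P.opposite.preSubgroup_opposite hf
  rwa [opposite_opposite] at this

theorem upperSpace_le_iff (P : IsUnitPair V e ê) (hf : IsPreSubgroup V e f) :
    upperSpace V f ≤ upperSpace V g ↔ V (g ⊗ₜ[ℂ] f) = g ⊗ₜ[ℂ] f :=
  ⟨fun h => h hf.map_tmul_self,
    P.mul.upperSpace_le (ne_zero_of_norm_eq_one hf.norm_eq_one)⟩

/-- Each inclusion amounts to V(g ⊗ f) = g ⊗ f, a condition stable under duality. -/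
theorem upperSpace_le_iff_lowerSpace_le (P : IsUnitPair V e ê) (hf : IsPreSubgroup V e f)
    (hg : IsPreSubgroup V e g) :
    upperSpace V f ≤ upperSpace V g ↔ lowerSpace V g ≤ lowerSpace V f := by
  rw [P.upperSpace_le_iff hf, ← upperSpace_opposite, ← upperSpace_opposite,
    P.opposite.upperSpace_le_iff (P.preSubgroup_opposite hg), opposite_tmul_eq_iff]

/-- Orthogonal projections with the same range agree, so ⟨f, e⟩ f = ⟨g, e⟩ g; positivity excludes a
phase. -/
theorem eq_of_upperSpace_eq (P : IsUnitPair V e ê) (hf : IsPreSubgroup V e f)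
    (hg : IsPreSubgroup V e g) (h : upperSpace V f = upperSpace V g) : f = g := by
  have hslice : leftSlice V f e = leftSlice V g e := by
    have key : ∀ {f g : H}, IsPreSubgroup V e f → IsPreSubgroup V e g →
        upperSpace V f = upperSpace V g → ∀ x, leftSlice V g (leftSlice V f x) = leftSlice V f x :=
      fun {f g} hf hg h x => (leftSlice_eq_self_iff hg.norm_eq_one _).2
        (h ▸ P.mul.leftSlice_mem hf.norm_eq_one hf.map_tmul_self x)
    refine ext_inner_left ℂ fun x => ?_
    rw [← key hf hg h, ← P.mul.leftSlice_isSymmetric hg.norm_eq_one hg.map_tmul_self,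
      ← P.mul.leftSlice_isSymmetric hf.norm_eq_one hf.map_tmul_self, key hg hf h.symm,
      P.mul.leftSlice_isSymmetric hg.norm_eq_one hg.map_tmul_self]
  rw [P.leftSlice_fixed hf, P.leftSlice_fixed hg] at hslice
  have hn : (inner ℂ f e : ℂ) = inner ℂ g e := by
    have h1 := congrArg (fun x => ‖x‖) hslice
    simp only [norm_smul, hf.norm_eq_one, hg.norm_eq_one, mul_one] at h1
    rw [← Complex.norm_of_nonneg' hf.inner_pos.le, ← Complex.norm_of_nonneg' hg.inner_pos.le, h1]
  rw [hn] at hslice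
  exact smul_right_injective H hg.inner_pos.ne' hslice

theorem exists_upperSpace_eq_inf (P : IsUnitPair V e ê) {f' : H} (hf : IsPreSubgroup V e f)
    (hf' : IsPreSubgroup V e f') :
    ∃ g, IsPreSubgroup V e g ∧ upperSpace V f ⊓ upperSpace V f' = upperSpace V g := by
  set K := upperSpace V f ⊓ upperSpace V f' with hK
  set k := K.starProjection e with hk
  have hkK : k ∈ K := Submodule.starProjection_apply_mem K e
  have hperp : e - k ∈ (upperSpace V f)ᗮ ⊔ (upperSpace V f')ᗮ := by
    have h : e - k ∈ Kᗮ := Submodule.sub_starProjection_mem_orthogonal e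
    have h2 : K = ((upperSpace V f)ᗮ ⊔ (upperSpace V f')ᗮ)ᗮ := by
      rw [← Submodule.inf_orthogonal, Submodule.orthogonal_orthogonal,
        Submodule.orthogonal_orthogonal]
    rwa [h2, Submodule.orthogonal_orthogonal] at h
  have hinv : ∀ {f η : H}, IsPreSubgroup V e f → η ∈ upperSpace V f → ∀ ω,
      (∀ x ∈ upperSpace V f, rightSlice V.symm ω η x ∈ upperSpace V f) ∧
      (∀ x ∈ (upperSpace V f)ᗮ, rightSlice V.symm ω η x ∈ (upperSpace V f)ᗮ) := by
    intro f η hf hη ω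
    have hsymm := P.mul.leftSlice_isSymmetric hf.norm_eq_one hf.map_tmul_self
    have hiff := leftSlice_eq_self_iff (V := V) hf.norm_eq_one
    have hperp : ∀ x, x ∈ (upperSpace V f)ᗮ ↔ leftSlice V f x = 0 := by
      intro x
      refine ⟨fun hx => ?_, fun hx => ?_⟩
      · refine ext_inner_left ℂ fun y => ?_
        rw [← hsymm, inner_zero_right]
        exact hx _ (P.mul.leftSlice_mem hf.norm_eq_one hf.map_tmul_self y)
      · intro u hu
        rw [← (hiff u).2 hu, hsymm, hx, inner_zero_right]
    refine ⟨fun x hx => ?_, fun x hx => ?_⟩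
    · rw [← hiff, P.mul.leftSlice_rightSlice_symm hη, (hiff x).2 hx]
    · rw [hperp, P.mul.leftSlice_rightSlice_symm hη, (hperp x).1 hx, map_zero]
  -- B acts on e by the scalar ⟨ω, η⟩ and preserves K and Kᗮ, so it acts by that scalar on the
  -- component k of e.
  have hslice : ∀ η ∈ K, ∀ ω, rightSlice V.symm ω η k = (inner ℂ ω η : ℂ) • k := by
    intro η hη ω
    set B := rightSlice V.symm ω η
    have hBe : B e = (inner ℂ ω η : ℂ) • e := by
      change rightContract H ω (V.symm (e ⊗ₜ[ℂ] η)) = _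
      rw [V.symm_apply_eq.2 (P.fixed η).symm, rightContract_tmul]
    have h1 : B k ∈ K := ⟨(hinv hf hη.1 ω).1 k hkK.1, (hinv hf' hη.2 ω).1 k hkK.2⟩
    have h2 : B (e - k) ∈ Kᗮ := by
      obtain ⟨u, hu, w, hw, huw⟩ := Submodule.mem_sup.1 hperp
      rw [← huw, map_add]
      exact add_mem (Submodule.orthogonal_le inf_le_left ((hinv hf hη.1 ω).2 u hu))
        (Submodule.orthogonal_le inf_le_right ((hinv hf' hη.2 ω).2 w hw))
    have h3 : B k - (inner ℂ ω η : ℂ) • k ∈ Kᗮ := by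
      have h4 : B k - (inner ℂ ω η : ℂ) • k = (inner ℂ ω η : ℂ) • (e - k) - B (e - k) := by
        rw [map_sub, hBe, smul_sub]; abel
      rw [h4]
      exact sub_mem (Submodule.smul_mem _ _ (Submodule.sub_starProjection_mem_orthogonal e)) h2
    have h5 := Submodule.inner_right_of_mem_orthogonal
      (sub_mem h1 (K.smul_mem (inner ℂ ω η : ℂ) hkK)) h3
    exact sub_eq_zero.1 (inner_self_eq_zero.1 h5)
  have hVk : ∀ η ∈ K, V (k ⊗ₜ[ℂ] η) = k ⊗ₜ[ℂ] η := by
    intro η hη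
    have h : V.symm (k ⊗ₜ[ℂ] η) = k ⊗ₜ[ℂ] η := by
      rw [← sum_rightContract_tmul (stdOrthonormalBasis ℂ H) (V.symm (k ⊗ₜ[ℂ] η))]
      conv_rhs => rw [← (stdOrthonormalBasis ℂ H).sum_repr' η, TensorProduct.tmul_sum]
      refine Finset.sum_congr rfl fun i _ => ?_
      rw [TensorProduct.tmul_smul, TensorProduct.smul_tmul', ← hslice η hη]
      rfl
    rw [← h, V.apply_symm_apply, h]
  -- The cofixed vector ê lies in K and is not orthogonal to e.
  have hk0 : k ≠ 0 := by
    intro h0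
    have h : e ∈ Kᗮ := by
      have := Submodule.sub_starProjection_mem_orthogonal (K := K) e
      rwa [← hk, h0, sub_zero] at this
    exact P.pos.ne' (h ê ⟨P.cofixed f, P.cofixed f'⟩)
  have hkn : ‖k‖ ≠ 0 := norm_ne_zero_iff.2 hk0
  have hgV : ∀ η ∈ K, V ((((‖k‖⁻¹ : ℝ) : ℂ) • k) ⊗ₜ[ℂ] η) =
      (((‖k‖⁻¹ : ℝ) : ℂ) • k) ⊗ₜ[ℂ] η := by
    intro η hη
    rw [← TensorProduct.smul_tmul', map_smul, hVk η hη]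
  have hg : IsPreSubgroup V e (((‖k‖⁻¹ : ℝ) : ℂ) • k) := by
    refine ⟨?_, ?_, hgV _ (K.smul_mem _ hkK)⟩
    · rw [norm_smul, Complex.norm_real, norm_inv, norm_norm, inv_mul_cancel₀ hkn]
    · have hke : (inner ℂ k e : ℂ) = ((‖k‖ ^ 2 : ℝ) : ℂ) := by
        have h := Submodule.inner_right_of_mem_orthogonal hkK
          (Submodule.sub_starProjection_mem_orthogonal (K := K) e)
        rw [← hk, inner_sub_right, sub_eq_zero] at h
        rw [h, inner_self_eq_norm_sq_to_K]
        simp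
      rw [inner_smul_left, Complex.conj_ofReal, hke, ← Complex.ofReal_mul, Complex.zero_lt_real]
      positivity
  refine ⟨_, hg, le_antisymm (fun η hη => hgV η hη) (le_inf ?_ ?_)⟩
  · exact (P.upperSpace_le_iff hg).2 (K.smul_mem _ hkK).1
  · exact (P.upperSpace_le_iff hg).2 (K.smul_mem _ hkK).2

theorem exists_lowerSpace_eq_inf (P : IsUnitPair V e ê) {f' : H} (hf : IsPreSubgroup V e f)
    (hf' : IsPreSubgroup V e f') :
    ∃ g, IsPreSubgroup V e g ∧ lowerSpace V f ⊓ lowerSpace V f' = lowerSpace V g := by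
  obtain ⟨g, hg, h⟩ := P.opposite.exists_upperSpace_eq_inf (P.preSubgroup_opposite hf)
    (P.preSubgroup_opposite hf')
  simp only [upperSpace_opposite] at h
  exact ⟨g, P.preSubgroup_of_opposite hg, h⟩

end IsUnitPair

/-! ### Existence of the cofixed vector. -/

variable {e ê : H}

/-- In multiplicity one there is a cofixed vector `q` of norm `n ^ (-1/2)`, the projection of the
unit fixed vector `e`, and every unit cofixed vector is proportional to it. -/
theorem IsMultiplicative.exists_cofixed (hV : IsMultiplicative V) (he : IsFixed V e)
    (he1 : ‖e‖ = 1) (hspan : ∀ ξ, IsFixed V ξ → ∃ c : ℂ, ξ = c • e) :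
    ∃ q, IsCofixed V q ∧ inner ℂ e q = (Module.finrank ℂ H : ℂ)⁻¹ ∧
      inner ℂ q q = (Module.finrank ℂ H : ℂ)⁻¹ ∧
      ∀ x, ‖x‖ = 1 → IsCofixed V x → q = (inner ℂ x e : ℂ) • x := by
  have : Nontrivial H := ⟨⟨e, 0, ne_zero_of_norm_eq_one he1⟩⟩
  have hn : (Module.finrank ℂ H : ℂ) ≠ 0 := Nat.cast_ne_zero.2 Module.finrank_pos.ne'
  set n : ℂ := (Module.finrank ℂ H : ℂ) with hndef
  have hnn : ‖n‖ = Module.finrank ℂ H := by simp [hndef]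
  have hidem : ∀ x, (n⁻¹ • character V) ((n⁻¹ • character V) x) = (n⁻¹ • character V) x := by
    intro x
    simp only [LinearMap.smul_apply, map_smul, hV.character_character]
    rw [← hndef, inv_smul_smul₀ hn]
  have hle : ∀ x, ‖(n⁻¹ • character V) x‖ ≤ ‖x‖ := by
    intro x
    rw [LinearMap.smul_apply, norm_smul, norm_inv, inv_mul_le_iff₀ (norm_pos_iff.2 hn), hnn]
    exact norm_character_le x
  have hsymm := isSymmetric_of_idempotent_of_norm_le hidem hle
  have hcof : ∀ x, IsCofixed V ((n⁻¹ • character V) x) := by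
    intro x
    refine isCofixed_of_character_apply ?_
    rw [← hndef, ← inv_smul_eq_iff₀ hn]
    exact hidem x
  have hfix : ∀ x, IsCofixed V x → (n⁻¹ • character V) x = x := by
    intro x hx
    rw [LinearMap.smul_apply, hx.character_apply, ← hndef, inv_smul_smul₀ hn]
  -- The trace of (id ⊗ ω_{e,e})V, a rank-one projection, is 1.
  have hinner : inner ℂ e ((n⁻¹ • character V) e) = n⁻¹ := by
    rw [LinearMap.smul_apply, inner_smul_right, character, LinearMap.sum_apply, inner_sum]
    simp only [inner_leftSlice, hV.inner_tmul_fixed he he1 hspan]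
    simp_rw [mul_comm (inner ℂ _ e : ℂ)]
    rw [(stdOrthonormalBasis ℂ H).sum_inner_mul_inner, inner_self_eq_norm_sq_to_K, he1]
    simp
  refine ⟨(n⁻¹ • character V) e, hcof e, hinner, ?_, fun x hx1 hx => ?_⟩
  · rw [hsymm, hidem, hinner]
  · have hxx := hx x
    rw [← hV.leftSlice_fixed he he1 hspan hx1 hxx]
    refine ext_inner_left ℂ fun y => ?_
    -- P_x is the identity on cofixed vectors, so pairing one with e is the same as pairing it with
    -- P_x e = ⟨x, e⟩ x.
    have h1 : leftSlice V x ((n⁻¹ • character V) y) = (n⁻¹ • character V) y :=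
      (leftSlice_eq_self_iff hx1 _).2 (hcof y x)
    rw [← hsymm, ← h1, hV.leftSlice_isSymmetric hx1 hxx, hV.leftSlice_fixed he he1 hspan hx1 hxx,
      hsymm, map_smul, hfix x hx]

/-! ### The lattice and the main theorem. -/

namespace IsUnitPair

/-- The pre-subgroups form a lattice for the inclusion of the spaces `H^f`. -/
noncomputable abbrev lattice (P : IsUnitPair V e ê) : Lattice (PreSubgroup V e) where
  le f g := upperSpace V f.1 ≤ upperSpace V g.1
  le_refl _ := le_refl _
  le_trans _ _ _ h h' := le_trans h h'
  le_antisymm f g h h' := Subtype.ext (P.eq_of_upperSpace_eq f.2 g.2 (le_antisymm h h'))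
  inf f g := ⟨(P.exists_upperSpace_eq_inf f.2 g.2).choose,
    (P.exists_upperSpace_eq_inf f.2 g.2).choose_spec.1⟩
  inf_le_left f g := (P.exists_upperSpace_eq_inf f.2 g.2).choose_spec.2.symm.le.trans inf_le_left
  inf_le_right f g := (P.exists_upperSpace_eq_inf f.2 g.2).choose_spec.2.symm.le.trans inf_le_right
  le_inf f g k h h' := (le_inf h h').trans (P.exists_upperSpace_eq_inf g.2 k.2).choose_spec.2.le
  sup f g := ⟨(P.exists_lowerSpace_eq_inf f.2 g.2).choose,
    (P.exists_lowerSpace_eq_inf f.2 g.2).choose_spec.1⟩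
  le_sup_left f g := (P.upperSpace_le_iff_lowerSpace_le f.2
    (P.exists_lowerSpace_eq_inf f.2 g.2).choose_spec.1).2
      ((P.exists_lowerSpace_eq_inf f.2 g.2).choose_spec.2.symm.le.trans inf_le_left)
  le_sup_right f g := (P.upperSpace_le_iff_lowerSpace_le g.2
    (P.exists_lowerSpace_eq_inf f.2 g.2).choose_spec.1).2
      ((P.exists_lowerSpace_eq_inf f.2 g.2).choose_spec.2.symm.le.trans inf_le_right)
  sup_le f g k h h' := (P.upperSpace_le_iff_lowerSpace_le
    (P.exists_lowerSpace_eq_inf f.2 g.2).choose_spec.1 k.2).2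
      ((le_inf ((P.upperSpace_le_iff_lowerSpace_le f.2 k.2).1 h)
        ((P.upperSpace_le_iff_lowerSpace_le g.2 k.2).1 h')).trans
          (P.exists_lowerSpace_eq_inf f.2 g.2).choose_spec.2.le)

end IsUnitPair

end MultiplicativeUnitary

theorem mainTheorem9 {H : Type*} [NormedAddCommGroup H] [InnerProductSpace ℂ H]
    [FiniteDimensional ℂ H] (V : (H ⊗[ℂ] H) ≃ₗᵢ[ℂ] (H ⊗[ℂ] H))
    (hV : MultiplicativeUnitary.IsMultiplicative V) (hm : MultiplicativeUnitary.mult V = 1)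
    (e : H) (he : MultiplicativeUnitary.IsFixed V e) (he1 : ‖e‖ = 1) :
    ∃ ê : H,
      -- `ê` is the unique cofixed vector with `⟨e, ê⟩ = n ^ (-1/2)`
      (MultiplicativeUnitary.IsCofixed V ê ∧
        inner ℂ e ê = (((√(Module.finrank ℂ H : ℝ))⁻¹ : ℝ) : ℂ)) ∧
      (∀ x : H, MultiplicativeUnitary.IsCofixed V x →
        inner ℂ e x = (((√(Module.finrank ℂ H : ℝ))⁻¹ : ℝ) : ℂ) → x = ê) ∧
      -- inclusion of the spaces `H^f` is a lattice order
      ∃ _ : Lattice (MultiplicativeUnitary.PreSubgroup V e),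
        (∀ f g : MultiplicativeUnitary.PreSubgroup V e, f ≤ g ↔
          MultiplicativeUnitary.upperSpace V f.1 ≤ MultiplicativeUnitary.upperSpace V g.1) ∧
        (∃ t : MultiplicativeUnitary.PreSubgroup V e, t.1 = e ∧ IsTop t) ∧
        (∃ b : MultiplicativeUnitary.PreSubgroup V e, b.1 = ê ∧ IsBot b) ∧
        (∀ f f' : MultiplicativeUnitary.PreSubgroup V e,
          ∃ g g' : MultiplicativeUnitary.PreSubgroup V e,
            MultiplicativeUnitary.upperSpace V f.1 ⊓ MultiplicativeUnitary.upperSpace V f'.1 =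
              MultiplicativeUnitary.upperSpace V g.1 ∧
            MultiplicativeUnitary.lowerSpace V f.1 ⊓ MultiplicativeUnitary.lowerSpace V f'.1 =
              MultiplicativeUnitary.lowerSpace V g'.1 ∧
            g = f ⊓ f' ∧ g' = f ⊔ f') := by
  have he0 := MultiplicativeUnitary.ne_zero_of_norm_eq_one he1
  have hspan : ∀ ξ, MultiplicativeUnitary.IsFixed V ξ → ∃ c : ℂ, ξ = c • e := by
    intro ξ hξ
    obtain ⟨c, hc⟩ := (finrank_eq_one_iff_of_nonzero'
      (⟨e, (MultiplicativeUnitary.mem_fixedSpace V e).2 he⟩ : MultiplicativeUnitary.fixedSpace V)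
      (fun h => he0 (congrArg Subtype.val h))).1 hm
      ⟨ξ, (MultiplicativeUnitary.mem_fixedSpace V ξ).2 hξ⟩
    exact ⟨c, (congrArg Subtype.val hc).symm⟩
  obtain ⟨q, hq, heq, hqq, huniq⟩ := hV.exists_cofixed he he1 hspan
  have : Nontrivial H := ⟨⟨e, 0, he0⟩⟩
  have hn : (0 : ℝ) < Module.finrank ℂ H := Nat.cast_pos.2 Module.finrank_pos
  set r : ℝ := √(Module.finrank ℂ H : ℝ) with hr
  have hr0 : 0 < r := Real.sqrt_pos.2 hn
  have hr2 : (Module.finrank ℂ H : ℂ) = (r : ℂ) ^ 2 := by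
    rw [← Complex.ofReal_pow, Real.sq_sqrt hn.le, Complex.ofReal_natCast]
  have hrc : (r : ℂ) ≠ 0 := Complex.ofReal_ne_zero.2 hr0.ne'
  rw [hr2] at heq hqq
  -- Since ‖q‖² = ⟨e, q⟩ = 1/n, the factor r = √n makes q a unit vector and gives it inner product
  -- n^(-1/2) with e.
  have hcof : MultiplicativeUnitary.IsCofixed V ((r : ℂ) • q) := by
    intro η
    rw [TensorProduct.tmul_smul, map_smul, hq η]
  have hinner : inner ℂ e ((r : ℂ) • q) = ((r⁻¹ : ℝ) : ℂ) := by
    rw [inner_smul_right, heq, Complex.ofReal_inv]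
    field_simp
  have hnorm : ‖(r : ℂ) • q‖ = 1 := by
    have h : (inner ℂ ((r : ℂ) • q) ((r : ℂ) • q) : ℂ) = 1 := by
      rw [inner_smul_right, inner_smul_left, hqq, Complex.conj_ofReal]
      field_simp
    rw [← sq_eq_sq₀ (norm_nonneg _) zero_le_one, ← inner_self_eq_norm_sq (𝕜 := ℂ), h]
    simp
  have hspan' : ∀ ξ, MultiplicativeUnitary.IsCofixed V ξ → ∃ c : ℂ, ξ = c • ((r : ℂ) • q) := by
    intro ξ hξ
    rcases eq_or_ne ξ 0 with rfl | hξ0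
    · exact ⟨0, by simp⟩
    have hξn : ‖ξ‖ ≠ 0 := norm_ne_zero_iff.2 hξ0
    set u : H := ((‖ξ‖⁻¹ : ℝ) : ℂ) • ξ with hu
    have hξu : ξ = (‖ξ‖ : ℂ) • u := by
      rw [hu, smul_smul, ← Complex.ofReal_mul, mul_inv_cancel₀ hξn, Complex.ofReal_one, one_smul]
    have h := huniq u
      (by rw [hu, norm_smul, Complex.norm_real, norm_inv, norm_norm, inv_mul_cancel₀ hξn])
      (fun η => by rw [hu, TensorProduct.tmul_smul, map_smul, hξ η])
    -- From q = ⟨u, e⟩ u and q ≠ 0 the scalar is invertible, so u lies on the line of q.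
    have h0 : (inner ℂ u e : ℂ) ≠ 0 := by
      intro h0
      rw [h0, zero_smul] at h
      rw [h, smul_zero, norm_zero] at hnorm
      exact zero_ne_one hnorm
    refine ⟨(‖ξ‖ : ℂ) * (inner ℂ u e)⁻¹ * (r : ℂ)⁻¹, ?_⟩
    rw [smul_smul, mul_assoc, inv_mul_cancel₀ hrc, mul_one, h, smul_smul, mul_assoc,
      inv_mul_cancel₀ h0, mul_one]
    exact hξu
  have P : MultiplicativeUnitary.IsUnitPair V e ((r : ℂ) • q) :=
    ⟨hV, he, he1, hspan, hcof, hnorm, hspan', MultiplicativeUnitary.inner_pos_symm (by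
      rw [hinner, Complex.zero_lt_real]; positivity)⟩
  refine ⟨(r : ℂ) • q, ⟨hcof, hinner⟩, ?_, P.lattice, fun _ _ => Iff.rfl, ?_, ?_, ?_⟩
  · intro x hx hex
    obtain ⟨c, rfl⟩ := hspan' x hx
    rw [inner_smul_right, hinner] at hex
    have : ((r⁻¹ : ℝ) : ℂ) ≠ 0 := Complex.ofReal_ne_zero.2 (inv_ne_zero hr0.ne')
    rw [mul_eq_right₀ this] at hex
    rw [hex, one_smul]
  · refine ⟨⟨e, he1, ?_, he e⟩, rfl, fun f η _ => he η⟩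
    rw [inner_self_eq_norm_sq_to_K, he1]
    simp
  · exact ⟨⟨(r : ℂ) • q, hnorm, P.pos, hcof _⟩, rfl,
      fun f => P.mul.upperSpace_le (MultiplicativeUnitary.ne_zero_of_norm_eq_one hnorm) (hcof f.1)⟩
  · intro f f'
    exact ⟨P.lattice.inf f f', P.lattice.sup f f',
      (P.exists_upperSpace_eq_inf f.2 f'.2).choose_spec.2,
      (P.exists_lowerSpace_eq_inf f.2 f'.2).choose_spec.2, rfl, rfl⟩
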